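/- Let $k,n,d$ be integers with $1<k<d\le n\le 2k-1$ and let $q$ be a prime with $q>d+k-1$. A $q$-ary quantum secret sharing scheme for a secret of $m$ qudits (of dimension $q$) and $n$ parties is a quantum operation that encodes the secret into $n$ shares, the $j$th share having $w_j$ qudits. It is a $((k,n))$ quantum threshold scheme (QTS) if from the shares of any $k$ or more parties an arbitrary state of the secret can be recovered by a quantum operation, while the joint state of the shares of any $k-1$ or fewer parties does not depend on the secret. For every set $D$ of at least $k$ parties the scheme prescribes which qudits of their shares these parties send to a combiner, who must be able to recover the secret from the qudits received; $\mathrm{CC}_n(\ell)$ is the maximum, over all sets $D$ of $\ell$ parties, of the number of qudits sent. The scheme is a $((k,n,d))$ communication efficient QTS (CE-QTS) scheme if moreover $\mathrm{CC}_n(d)<\mathrm{CC}_n(k)$. Put $m=d-k+1$ and $N=d+k-1$. Choose distinct nonzero $x_1,\dots,x_N\in\mathbb F_q$ and distinct $y_1,\dots,y_{2k-1}\in\mathbb F_q$ (such elements exist). Encode the secret in two layers. 1. (Ogawa et al. ramp scheme.) Encode $m$ qudits into $N$ qudits by $$|s_1\cdots s_m\rangle\mapsto q^{-(k-1)/2}\sum_{r\in\mathbb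 F_q^{k-1}}\bigotimes_{i=1}^{N}\Big|\sum_{a=1}^{m}s_a x_i^{a-1}+\sum_{b=1}^{k-1}r_b x_i^{m+b-1}\Big\rangle ,$$ call the first $n+d-k$ output qudits $A_1,\dots,A_{n+d-k}$ and discard the remaining $2k-1-n$. 2. (Cleve et al. threshold scheme.) Encode each of the qudits $A_{n+1},\dots,A_{n+d-k}$ separately by $$|s\rangle\mapsto q^{-(k-1)/2}\sum_{r\in\mathbb F_q^{k-1}}\bigotimes_{i=1}^{2k-1}\Big|\sum_{b=1}^{k-1}r_b y_i^{b-1}+s\,y_i^{k-1}\Big\rangle ,$$ discard the last $2k-1-n$ output qudits of each of these $d-k$ encodings, and for $1\le j\le n$ let $B_j$ consist of the $j$th output qudits of the $d-k$ encodings. The $j$th share is $S_j=(A_j,B_j)$, $1\le j\le n$. When exactly $d$ parties are contacted, each party $j$ among them sends only $A_j$; otherwise the contacted parties send their full shares. For every such choice of the $x_i$ and $y_i$, this is a $q$-ary $((k,n,d))$ CE-QTS scheme for a secret of $m=d-k+1$ qudits with $$w_1=w_2=\cdots=w_n=d-k+1,\qquad \mathrm{CC}_n(k)=k(d-k+1),\qquad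 \mathrm{CC}_n(d)=d .$$ -/

import Mathlib

open Matrix
open scoped ComplexOrder

noncomputable section

/-! ## Quantum states, quantum operations, partial traces

A system of `q`-dimensional qudits labelled by a finite type `Q` has the standard basis
`Q → ZMod q`, and its operators are complex matrices indexed by `Q → ZMod q`. -/

/-- Operators on a system of `q`-dimensional qudits labelled by `Q`. -/
abbrev QOp (q : ℕ) (Q : Type) : Type := Matrix (Q → ZMod q) (Q → ZMod q) ℂ

/-- Density matrices: positive semidefinite of trace one. -/
def IsDensity {a : Type} [Fintype a] (ρ : Matrix a a ℂ) : Prop :=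
  ρ.PosSemidef ∧ ρ.trace = 1

/-- Quantum operations (completely positive trace-preserving maps), in operator-sum form:
`Φ ρ = ∑ᵢ Kᵢ ρ Kᵢᴴ` with `∑ᵢ Kᵢᴴ Kᵢ = 1`. -/
def IsQuantumOperation {a b : Type} [Fintype a] [DecidableEq a] [Fintype b]
    (Φ : Matrix a a ℂ → Matrix b b ℂ) : Prop :=
  ∃ (r : ℕ) (K : Fin r → Matrix b a ℂ),
    ∑ i, (K i)ᴴ * K i = 1 ∧ ∀ ρ, Φ ρ = ∑ i, K i * ρ * (K i)ᴴ

/-- The basis label of the whole system which is `a` on the qudits in `T` and `c` on the others. -/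
def glue {F Q : Type} [DecidableEq Q] (T : Finset Q) (a : {x // x ∈ T} → F)
    (c : {x // x ∉ T} → F) : Q → F :=
  fun x => if h : x ∈ T then a ⟨x, h⟩ else c ⟨x, h⟩

/-- The reduced state on the qudits in `T`: all other qudits are traced out. -/
def reducedState {q : ℕ} [NeZero q] {Q : Type} [Fintype Q] [DecidableEq Q] (T : Finset Q)
    (ρ : QOp q Q) : QOp q {x // x ∈ T} :=
  Matrix.of fun a b => ∑ c : {x // x ∉ T} → ZMod q, ρ (glue T a c) (glue T b c)

/-- Discarding the qudits `E` of a system with qudits `Q ⊕ E` (partial trace over `E`). -/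
def discard {q : ℕ} [NeZero q] {Q E : Type} [Fintype E] [DecidableEq E]
    (ρ : QOp q (Q ⊕ E)) : QOp q Q :=
  Matrix.of fun a b => ∑ e : E → ZMod q, ρ (Sum.elim a e) (Sum.elim b e)

/-! ## Quantum secret sharing -/

/-- The data of a `q`-ary secret sharing scheme for `n` parties with a secret of `m` qudits:
* `Q` labels all the qudits that are distributed, `owner x` is the party that receives `x`;
* `encode` sends the state of the secret to the joint state of the shares;
* `sent D` is the set of qudits that the combiner downloads when contacting the parties in `D`. -/
structure QSSScheme (q m n : ℕ) (Q : Type) where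
  owner : Q → Fin n
  encode : QOp q (Fin m) → QOp q Q
  sent : Finset (Fin n) → Finset Q

namespace QSSScheme

variable {q m n : ℕ} {Q : Type} [NeZero q] [Fintype Q] [DecidableEq Q]

/-- All the qudits in the shares of the parties in `A`. -/
def shares (S : QSSScheme q m n Q) (A : Finset (Fin n)) : Finset Q :=
  Finset.univ.filter fun x => S.owner x ∈ A

/-- The size `w_j` of the share of party `j`, in qudits. -/
def shareSize (S : QSSScheme q m n Q) (j : Fin n) : ℕ := (S.shares {j}).card

/-- The secret, in an arbitrary state, can be recovered from the qudits in `T` by some quantum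
operation. -/
def RecoverableFrom (S : QSSScheme q m n Q) (T : Finset Q) : Prop :=
  ∃ R : QOp q {x // x ∈ T} → QOp q (Fin m), IsQuantumOperation R ∧
    ∀ ρ : QOp q (Fin m), IsDensity ρ → R (reducedState T (S.encode ρ)) = ρ

/-- The qudits in `T` have no information on the secret: their state does not depend on it. -/
def NoInformation (S : QSSScheme q m n Q) (T : Finset Q) : Prop :=
  ∀ ρ σ : QOp q (Fin m), IsDensity ρ → IsDensity σ →
    reducedState T (S.encode ρ) = reducedState T (S.encode σ)

/-- `S` is a quantum secret sharing scheme for the access structure `Γ`. -/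
structure Realizes (S : QSSScheme q m n Q) (Γ : Set (Finset (Fin n))) : Prop where
  operation : IsQuantumOperation S.encode
  recoverability : ∀ A ∈ Γ, S.RecoverableFrom (S.shares A)
  secrecy : ∀ B ∉ Γ, S.NoInformation (S.shares B)

/-- `((k, n))` quantum threshold schemes. -/
structure IsQTS (S : QSSScheme q m n Q) (k : ℕ) : Prop where
  one_lt : 1 < k
  le_n : k ≤ n
  n_le : n ≤ 2 * k - 1
  realizes : S.Realizes {A | k ≤ A.card}

/-- The prescribed communication is legitimate for threshold `k`: every authorized set `D` sends
only qudits from the shares of its own parties, and the combiner can recover the secret from the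
qudits sent. -/
def ValidCommunication (S : QSSScheme q m n Q) (k : ℕ) : Prop :=
  ∀ D : Finset (Fin n), k ≤ D.card → S.sent D ⊆ S.shares D ∧ S.RecoverableFrom (S.sent D)

/-- The communication cost `CC_n(d)`: the maximum over all sets `D` of `d` parties of the number
of qudits sent to the combiner by the parties in `D`. -/
def commCost (S : QSSScheme q m n Q) (d : ℕ) : ℕ :=
  ((Finset.univ : Finset (Fin n)).powersetCard d).sup fun D => (S.sent D).card

/-- `((k, n, d))` communication efficient quantum threshold schemes. -/
structure IsCEQTS (S : QSSScheme q m n Q) (k d : ℕ) : Prop where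
  qts : S.IsQTS k
  k_lt : k < d
  le_n : d ≤ n
  valid : S.ValidCommunication k
  efficient : S.commCost d < S.commCost k

end QSSScheme

/-! ## The Ogawa ramp scheme and the Cleve threshold scheme -/

/-- The linear map `|s⟩ ↦ |R|^{-1/2} ∑_{r ∈ R} |f(s,r)⟩`, as a matrix. -/
def superpose {s R u : Type} [Fintype R] [DecidableEq u] (f : s → R → u) : Matrix u s ℂ :=
  Matrix.of fun b a =>
    ((Real.sqrt (Fintype.card R : ℝ))⁻¹ : ℂ) * ∑ r : R, if f a r = b then 1 else 0

/-- The labels `u_i(s,r) = s_1 + s_2 x_i + ⋯ + s_m x_i^{m-1} + r_1 x_i^m + ⋯ + r_z x_i^{m+z-1}`. -/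
def ogawaWord {q : ℕ} {ι : Type} (m z : ℕ) (x : ι → ZMod q) (s : Fin m → ZMod q)
    (r : Fin z → ZMod q) : ι → ZMod q :=
  fun i => (∑ a, s a * x i ^ (a : ℕ)) + ∑ b, r b * x i ^ (m + (b : ℕ))

/-- The Ogawa ramp encoding of `m` qudits, with `z` random symbols and one qudit per share. -/
def ogawaEncoding {q : ℕ} [NeZero q] {ι : Type} [Fintype ι] (m z : ℕ)
    (x : ι → ZMod q) : Matrix (ι → ZMod q) (Fin m → ZMod q) ℂ :=
  superpose (ogawaWord m z x)

/-- The labels `v_i(r,s) = r_1 + r_2 y_i + ⋯ + r_{k-1} y_i^{k-2} + s y_i^{k-1}`. -/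
def cleveWord {q : ℕ} {ι : Type} (k : ℕ) (y : ι → ZMod q) (s : ZMod q)
    (r : Fin (k - 1) → ZMod q) : ι → ZMod q :=
  fun i => (∑ b, r b * y i ^ (b : ℕ)) + s * y i ^ (k - 1)

/-- The Cleve threshold encoding of one qudit, with one qudit per share. -/
def cleveEncoding {q : ℕ} [NeZero q] {ι : Type} [Fintype ι] (k : ℕ)
    (y : ι → ZMod q) : Matrix (ι → ZMod q) (ZMod q) ℂ :=
  superpose (cleveWord k y)

/-! ## The concatenated scheme

Put `e = 2k - 1 - n`. The ramp code has the `n + (d-k) + e = d + k - 1` shares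
`(Fin n ⊕ Fin (d-k)) ⊕ Fin e`: the shares `A_1, …, A_n`, the shares `A_{n+1}, …, A_{n+d-k}`, and
`e` shares that are discarded. The threshold code has the `2k - 1` shares `Fin n ⊕ Fin e`, the last
`e` of which are discarded; it is applied to each of `A_{n+1}, …, A_{n+d-k}` separately. -/

/-- The ramp shares. -/
abbrev RampShare (k n d : ℕ) : Type := (Fin n ⊕ Fin (d - k)) ⊕ Fin (2 * k - 1 - n)

/-- The threshold shares. -/
abbrev ThresholdShare (k n : ℕ) : Type := Fin n ⊕ Fin (2 * k - 1 - n)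

/-- The distributed qudits. `Sum.inl j` is `A_j`, the first layer of the share of party `j`;
`Sum.inr (l, j)` is the qudit of its second layer `B_j` that comes from encoding `A_{n+l}`. -/
abbrev ShareQudit (k n d : ℕ) : Type := Fin n ⊕ Fin (d - k) × Fin n

/-- The discarded qudits of the two layers. -/
abbrev DiscardedQudit (k n d : ℕ) : Type :=
  Fin (2 * k - 1 - n) ⊕ Fin (d - k) × Fin (2 * k - 1 - n)

/-- The layer 2 operation: the identity on all the ramp shares except `A_{n+1}, …, A_{n+d-k}`, and
the threshold encoding on each of the latter. -/
def layerTwo {q : ℕ} [NeZero q] (k n d : ℕ) (y : ThresholdShare k n → ZMod q) :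
    Matrix (ShareQudit k n d ⊕ DiscardedQudit k n d → ZMod q) (RampShare k n d → ZMod q) ℂ :=
  Matrix.of fun w u =>
    (if (∀ j, w (Sum.inl (Sum.inl j)) = u (Sum.inl (Sum.inl j))) ∧
        (∀ i, w (Sum.inr (Sum.inl i)) = u (Sum.inr i)) then 1 else 0) *
      ∏ l : Fin (d - k), cleveEncoding k y
        (Sum.elim (fun j => w (Sum.inl (Sum.inr (l, j)))) (fun i => w (Sum.inr (Sum.inr (l, i)))))
        (u (Sum.inl (Sum.inr l)))

/-- Both layers of encoding, before the superfluous qudits are discarded. -/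
def concatEncoding {q : ℕ} [NeZero q] (k n d : ℕ) (x : RampShare k n d → ZMod q)
    (y : ThresholdShare k n → ZMod q) :
    Matrix (ShareQudit k n d ⊕ DiscardedQudit k n d → ZMod q) (Fin (d - k + 1) → ZMod q) ℂ :=
  layerTwo k n d y * ogawaEncoding (d - k + 1) (k - 1) x

/-- The concatenated scheme. When `d` parties are contacted, they send the first layers of their
shares; otherwise the parties that are contacted send their full shares. -/
def concatScheme {q : ℕ} [NeZero q] (k n d : ℕ) (x : RampShare k n d → ZMod q)
    (y : ThresholdShare k n → ZMod q) : QSSScheme q (d - k + 1) n (ShareQudit k n d) where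
  owner := Sum.elim id Prod.snd
  encode ρ := discard (concatEncoding k n d x y * ρ * (concatEncoding k n d x y)ᴴ)
  sent D :=
    if D.card = d then D.map Function.Embedding.inl
    else Finset.univ.filter fun p => Sum.elim id Prod.snd p ∈ D

end

/-! Both layers together send the secret `s` to the uniform superposition of the words `f (s, r)` of
an injective linear map `f`, so everything reduces to linear algebra over the field. Split the
qudits, discarded ones included, into an inside `T` and an outside. The secret is recoverable from
`T` if the inside word determines `s` and, for every `s`, some `r` makes the outside word zero
(`exists_recovery`). With inside and outside exchanged, the same two conditions make the state on
`T` independent of the secret (`superposedReduction_eq_trace_mul`).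

The conditions come from counting zeros of polynomials. Index whole shares, discarded ones included,
by the `2k - 1` threshold positions. A codeword vanishing on `k` positions is zero
(`eq_zero_of_vanishesOn`), while every secret has a codeword vanishing on any given `k - 1`
positions (`exists_vanishesOn`). A set of positions has at least `k` elements exactly when its
complement has at most `k - 1`, which gives both recovery and secrecy. For `d` first layers, the `d`
values determine a ramp polynomial with `d` coefficients, and the ramp shares outside number exactly
`k - 1`, so the `k - 1` random symbols can cancel them. -/

/-! ### Interpolation and linear algebra -/

theorem coeff_eq_zero_of_many_roots {F ι : Type} [Field F] {N : ℕ} {x : ι → F}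
    (hx : Function.Injective x) (J : Finset ι) (hJ : N ≤ J.card) (c : Fin N → F)
    (h : ∀ i ∈ J, ∑ a, c a * x i ^ (a : ℕ) = 0) : c = 0 := by
  classical
  set p : Polynomial F := ∑ a : Fin N, Polynomial.C (c a) * Polynomial.X ^ (a : ℕ) with hp
  have hdeg : p.degree < (J.card : ℕ) :=
    (Polynomial.degree_sum_fin_lt c).trans_le (by exact_mod_cast hJ)
  have hp0 : p = 0 := by
    refine Polynomial.eq_zero_of_degree_lt_of_eval_index_eq_zero (s := J) (v := x)
      hx.injOn hdeg ?_
    intro i hi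
    simpa [hp, Polynomial.eval_finsetSum] using h i hi
  funext a
  have := congrArg (fun r => Polynomial.coeff r (a : ℕ)) hp0
  simpa [hp, Polynomial.finsetSum_coeff, Polynomial.coeff_C_mul, Polynomial.coeff_X_pow,
    Fin.val_inj] using this

theorem exists_coeff_interpolating {F ι : Type} [Field F] {N : ℕ} {x : ι → F}
    (hx : Function.Injective x) (J : Finset ι) (hJ : J.card ≤ N) (v : ι → F) :
    ∃ c : Fin N → F, ∀ i ∈ J, ∑ a, c a * x i ^ (a : ℕ) = v i := by
  classical
  have hdeg : (Lagrange.interpolate J x v).degree < (N : ℕ) :=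
    (Lagrange.degree_interpolate_lt v (s := J) hx.injOn).trans_le (by exact_mod_cast hJ)
  refine ⟨fun a => (Lagrange.interpolate J x v).coeff a, fun i hi => ?_⟩
  rw [← Lagrange.eval_interpolate_at_node v hx.injOn hi, Polynomial.eval_eq_sum,
    Polynomial.sum_fin (fun e a => a * x i ^ e) (by simp) hdeg]

theorem exists_linear_factor {F M N P : Type} [Field F] [AddCommGroup M] [AddCommGroup N]
    [AddCommGroup P] [Module F M] [Module F N] [Module F P] (f : M →ₗ[F] N) (p : M →ₗ[F] P)
    (h : ∀ v, f v = 0 → p v = 0) : ∃ g : N →ₗ[F] P, ∀ v, g (f v) = p v := by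
  obtain ⟨l, hl⟩ := LinearMap.exists_leftInverse_of_injective
    (LinearMap.range f).subtype (Submodule.ker_subtype _)
  obtain ⟨j, hj⟩ := LinearMap.exists_rightInverse_of_surjective f.rangeRestrict
    f.range_rangeRestrict
  refine ⟨p ∘ₗ j ∘ₗ l, fun v => ?_⟩
  have h1 : l (f v) = f.rangeRestrict v := LinearMap.congr_fun hl (f.rangeRestrict v)
  have h2 : f.rangeRestrict (j (f.rangeRestrict v)) = f.rangeRestrict v :=
    LinearMap.congr_fun hj _
  have h3 : f (j (f.rangeRestrict v)) = f v := congrArg Subtype.val h2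
  rw [LinearMap.comp_apply, LinearMap.comp_apply, h1, ← sub_eq_zero, ← map_sub]
  exact h _ (by rw [map_sub, h3, sub_self])

/-! ### Uniform superpositions of words -/

theorem inv_sqrt_mul_inv_sqrt (a : ℕ) :
    (((Real.sqrt (a : ℝ))⁻¹ : ℝ) : ℂ) * ((Real.sqrt (a : ℝ))⁻¹ : ℝ) = (a : ℂ)⁻¹ := by
  rw [← Complex.ofReal_mul, ← mul_inv, Real.mul_self_sqrt (Nat.cast_nonneg _)]
  simp

theorem superpose_mul_mul_conjTranspose_apply {s R u : Type} [Fintype s] [Fintype R]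
    [DecidableEq u] (f : s → R → u) (ρ : Matrix s s ℂ) (a b : u) :
    (superpose f * ρ * (superpose f)ᴴ) a b = (Fintype.card R : ℂ)⁻¹ *
      ∑ i, ∑ j, ρ i j * ∑ r, ∑ t, if f i r = a ∧ f j t = b then 1 else 0 := by
  have hc := inv_sqrt_mul_inv_sqrt (Fintype.card R)
  have h0 : (superpose f * ρ * (superpose f)ᴴ) a b =
      ∑ i, ∑ j, superpose f a i * ρ i j * star (superpose f b j) := by
    rw [Matrix.mul_apply, Finset.sum_comm]
    refine Finset.sum_congr rfl fun j _ => ?_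
    rw [Matrix.mul_apply, Finset.sum_mul, Matrix.conjTranspose_apply]
  rw [h0, ← hc, Finset.mul_sum]
  refine Finset.sum_congr rfl fun i _ => ?_
  rw [Finset.mul_sum]
  refine Finset.sum_congr rfl fun j _ => ?_
  have h : ∀ r t, (if f i r = a ∧ f j t = b then (1 : ℂ) else 0) =
      (if f i r = a then 1 else 0) * (if f j t = b then 1 else 0) := by
    intro r t
    split_ifs <;> simp_all
  simp only [h, ← Finset.mul_sum, ← Finset.sum_mul]
  simp only [superpose, Matrix.of_apply, star_mul', star_sum, RCLike.star_def,
    apply_ite (starRingEnd ℂ), map_one, map_zero, map_inv₀, Complex.conj_ofReal,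
    Complex.ofReal_inv]
  ring

/-- An entry of the Gram matrix counts the coincidences `f i r = f j t`; by injectivity these are
the `card R` diagonal ones when `i = j`, and none otherwise. -/
theorem isometry_superpose {s R u : Type} [Fintype R] [Nonempty R] [Fintype u] [DecidableEq u]
    [DecidableEq s] (f : s → R → u) (hf : ∀ i j r t, f i r = f j t → i = j ∧ r = t) :
    (superpose f)ᴴ * superpose f = 1 := by
  have hc := inv_sqrt_mul_inv_sqrt (Fintype.card R)
  ext i j
  have h1 : ((superpose f)ᴴ * superpose f) i j = (Fintype.card R : ℂ)⁻¹ *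
      ∑ r, ∑ t, if f i r = f j t then 1 else 0 := by
    have h2 : ∀ r t, (if f i r = f j t then (1 : ℂ) else 0) =
        ∑ b, (if f i r = b then 1 else 0) * (if f j t = b then 1 else 0) := by
      intro r t
      simp [eq_comm]
    simp only [h2]
    rw [Finset.sum_congr rfl fun r _ => Finset.sum_comm, Finset.sum_comm, ← hc, Finset.mul_sum,
      Matrix.mul_apply]
    refine Finset.sum_congr rfl fun b _ => ?_
    simp only [← Finset.mul_sum, ← Finset.sum_mul]
    simp only [superpose, Matrix.conjTranspose_apply, Matrix.of_apply,
      star_mul', star_sum, RCLike.star_def, apply_ite (starRingEnd ℂ), map_one, map_zero,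
      map_inv₀, Complex.conj_ofReal, Complex.ofReal_inv]
    ring
  rw [h1]
  by_cases hij : i = j
  · subst hij
    have h3 : ∀ r t, (f i r = f i t) ↔ r = t :=
      fun r t => ⟨fun h => (hf _ _ _ _ h).2, fun h => h ▸ rfl⟩
    classical
    simp [h3]
  · have h3 : ∀ r t, ¬ (f i r = f j t) := fun r t h => hij (hf _ _ _ _ h).1
    simp [h3, hij]

/-- The state left of the superposition of the words `(f (i, r), g (i, r))` when the second
components are traced out. -/
noncomputable def superposedReduction {s R A B : Type} [Fintype s] [Fintype R] [DecidableEq A]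
    [DecidableEq B] (f : s × R → A) (g : s × R → B) (ρ : Matrix s s ℂ) : Matrix A A ℂ :=
  Matrix.of fun a b => (Fintype.card R : ℂ)⁻¹ * ∑ i, ∑ j, ρ i j *
    ∑ r, ∑ t, if f (i, r) = a ∧ f (j, t) = b ∧ g (i, r) = g (j, t) then 1 else 0

/-! ### Recovery and secrecy for linear codes -/

section LinearCodes

variable {F M R A B : Type} [Field F] [AddCommGroup M] [AddCommGroup R] [AddCommGroup A]
  [AddCommGroup B] [Module F M] [Module F R] [Module F A] [Module F B] [Fintype M] [Fintype R]
  [DecidableEq A] [DecidableEq B] (f : M × R →ₗ[F] A) (g : M × R →ₗ[F] B)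

/-- The outside word determines the secret, so tracing it out kills the terms with `i ≠ j`.
Translating `r` and `t` by a `u` with `f (i, u) = 0` turns each diagonal term into the one for
secret `0`. -/
theorem superposedReduction_eq_trace_mul (hg : ∀ v, g v = 0 → v.1 = 0)
    (hf : ∀ i, ∃ r, f (i, r) = 0) (ρ : Matrix M M ℂ) (a b : A) :
    superposedReduction f g ρ a b = (Fintype.card R : ℂ)⁻¹ * (ρ.trace *
      ∑ r, ∑ t, if f (0, r) = a ∧ f (0, t) = b ∧ g (0, r) = g (0, t) then 1 else 0) := by
  rw [superposedReduction, Matrix.of_apply, Matrix.trace, Finset.sum_mul]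
  congr 1
  refine Finset.sum_congr rfl fun i _ => ?_
  rw [Finset.sum_eq_single i]
  · rw [Matrix.diag_apply]
    congr 1
    obtain ⟨u, hu⟩ := hf i
    symm
    refine Fintype.sum_equiv (Equiv.addRight u) _ _ fun r => ?_
    refine Fintype.sum_equiv (Equiv.addRight u) _ _ fun t => ?_
    have h : ∀ r, ((i, r + u) : M × R) = (0, r) + (i, u) := by intro r; simp
    simp only [Equiv.coe_addRight, h, map_add, hu, add_zero, add_left_inj]
  · intro j _ hj
    have h : ∀ r t, ¬ (g (i, r) = g (j, t)) := by
      intro r t h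
      have := hg ((i, r) - (j, t)) (by rw [map_sub, h, sub_self])
      exact hj (sub_eq_zero.mp this).symm
    simp [h]
  · simp

/-- Choose `u i` with `g (i, u i) = 0`. Then `f (i, r) = f (i, u i) + f (0, r - u i)` and `g (i, r)
= g (0, r - u i)`: in the coordinates `(i, z)` with `a = f (i, u i) + z`, the secret is in a product
state with `z` and the outside. Recovery discards `z`. -/
theorem exists_recovery [Fintype A] [DecidableEq M] (hinj : ∀ v, f v = 0 → g v = 0 → v = 0)
    (hf : ∀ v, f v = 0 → v.1 = 0) (hg : ∀ i, ∃ r, g (i, r) = 0) :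
    ∃ Φ : Matrix A A ℂ → Matrix M M ℂ, IsQuantumOperation Φ ∧
      ∀ ρ, Φ (superposedReduction f g ρ) = ρ := by
  obtain ⟨p, hp⟩ := exists_linear_factor f (LinearMap.fst F M R) hf
  choose u hu using hg
  have hpf : ∀ i r, p (f (i, r)) = i := fun i r => hp (i, r)
  let Z := {z : A // p z = 0}
  let e := (Fintype.equivFin Z).symm
  let K : Z → Matrix M A ℂ := fun z => Matrix.of fun i a => if f (i, u i) + z = a then 1 else 0
  have hK : ∀ z (σ : Matrix A A ℂ) i j,
      (K z * σ * (K z)ᴴ) i j = σ (f (i, u i) + z) (f (j, u j) + z) := by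
    intro z σ i j
    simp [K, Matrix.mul_apply, Matrix.conjTranspose_apply, apply_ite (starRingEnd ℂ)]
  refine ⟨fun σ => ∑ l, K (e l) * σ * (K (e l))ᴴ, ⟨_, fun l => K (e l), ?_, fun _ => rfl⟩, ?_⟩
  · rw [Equiv.sum_comp e (fun z => (K z)ᴴ * K z)]
    ext a b
    rw [Matrix.sum_apply]
    -- Since `p` is defined on all of `A`, every label, codeword or not, has unique coordinates `(p
    -- a, z)`; this makes the operation trace preserving on the whole space.
    have h1 : ∀ (z : Z) i, f (i, u i) + z = a ↔ z = ⟨a - f (p a, u (p a)), by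
        rw [map_sub, hpf, sub_self]⟩ ∧ i = p a := by
      rintro ⟨z, hz⟩ i
      constructor
      · rintro rfl
        simp [hpf, hz]
      · rintro ⟨h, rfl⟩
        exact add_eq_of_eq_sub' (Subtype.ext_iff.mp h)
    have h2 : ∀ z, ((K z)ᴴ * K z) a b = ∑ i, if f (i, u i) + z = a then
        (if a = b then 1 else 0) else 0 := by
      intro z
      rw [Matrix.mul_apply]
      refine Finset.sum_congr rfl fun i _ => ?_
      by_cases h : f (i, u i) + z = a
      · simp [K, h]
      · simp [K, h]
    simp only [h2, h1, ite_and]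
    simp [Matrix.one_apply]
  · intro ρ
    ext i₀ j₀
    change (∑ l, K (e l) * superposedReduction f g ρ * (K (e l))ᴴ) i₀ j₀ = ρ i₀ j₀
    rw [Equiv.sum_comp e (fun z => K z * superposedReduction f g ρ * (K z)ᴴ), Matrix.sum_apply]
    simp only [hK, superposedReduction, Matrix.of_apply]
    rw [← Finset.mul_sum, Finset.sum_comm]
    have hoff : ∀ i j, (i ≠ i₀ ∨ j ≠ j₀) → ∀ z : Z, ∀ r t, ¬ (f (i, r) = f (i₀, u i₀) + z ∧
        f (j, t) = f (j₀, u j₀) + z ∧ g (i, r) = g (j, t)) := by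
      rintro i j hij z r t ⟨h1, h2, -⟩
      have h1 := congrArg p h1
      have h2 := congrArg p h2
      rw [map_add, hpf, hpf, z.2, add_zero] at h1 h2
      tauto
    rw [Finset.sum_eq_single i₀ _ (by simp), Finset.sum_comm, Finset.sum_eq_single j₀ _ (by simp)]
    · rw [← Finset.mul_sum]
      -- After translation to secret `0`, injectivity forces `t = r` and each `r` occurs for exactly
      -- one `z`; the count `card R` cancels the normalization.
      have hcount : ∑ z : Z, ∑ r, ∑ t, (if f (i₀, r) = f (i₀, u i₀) + z ∧
          f (j₀, t) = f (j₀, u j₀) + z ∧ g (i₀, r) = g (j₀, t) then (1 : ℂ) else 0) =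
          Fintype.card R := by
        have h1 : ∀ z : Z, ∑ r, ∑ t, (if f (i₀, r) = f (i₀, u i₀) + z ∧
            f (j₀, t) = f (j₀, u j₀) + z ∧ g (i₀, r) = g (j₀, t) then (1 : ℂ) else 0) =
            ∑ r, ∑ t, if f (0, r) = z ∧ f (0, t) = z ∧ g (0, r) = g (0, t) then (1 : ℂ) else 0 := by
          intro z
          symm
          refine Fintype.sum_equiv (Equiv.addRight (u i₀)) _ _ fun r => ?_
          refine Fintype.sum_equiv (Equiv.addRight (u j₀)) _ _ fun t => ?_
          have h : ∀ i r, ((i, r + u i) : M × R) = (0, r) + (i, u i) := by intro i r; simp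
          simp only [Equiv.coe_addRight, h, map_add, hu, add_zero]
          simp only [add_comm _ (z : A), add_left_inj]
        classical
        have h2 : ∀ (z : Z) r t, (f (0, r) = z ∧ f (0, t) = z ∧ g (0, r) = g (0, t)) ↔
            (z = ⟨f (0, r), hpf 0 r⟩ ∧ r = t) := by
          intro z r t
          constructor
          · rintro ⟨h1, h2, h3⟩
            refine ⟨Subtype.ext h1.symm, ?_⟩
            have := hinj ((0, r) - (0, t)) (by rw [map_sub, h1, h2, sub_self])
              (by rw [map_sub, h3, sub_self])
            exact sub_eq_zero.mp (congrArg Prod.snd this)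
          · rintro ⟨rfl, rfl⟩
            simp
        simp only [h1, h2]
        have h3 : ∀ r, ∑ z : Z, ∑ t, (if z = ⟨f (0, r), hpf 0 r⟩ ∧ r = t then (1 : ℂ) else 0) =
            1 := by
          intro r
          rw [Fintype.sum_eq_single ⟨f (0, r), hpf 0 r⟩ fun z hz => by simp [hz]]
          simp
        rw [Finset.sum_comm, Finset.sum_congr rfl fun r _ => h3 r]
        simp
      rw [hcount]
      have : (Fintype.card R : ℂ) ≠ 0 := by simp
      field_simp
    · intro j _ hj
      simp [hoff _ _ (Or.inr hj)]
    · intro i _ hi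
      simp [hoff _ _ (Or.inl hi)]

end LinearCodes

/-! ### Kraus operators of an isometry followed by a partial trace -/

theorem isQuantumOperation_of_kraus {a b ι : Type} [Fintype a] [DecidableEq a] [Fintype b]
    [Fintype ι] (K : ι → Matrix b a ℂ) (hK : ∑ i, (K i)ᴴ * K i = 1) :
    IsQuantumOperation fun ρ : Matrix a a ℂ => ∑ i, K i * ρ * (K i)ᴴ := by
  let e := (Fintype.equivFin ι).symm
  refine ⟨_, fun l => K (e l), ?_, fun ρ => ?_⟩
  · rw [← hK]
    exact Equiv.sum_comp e fun i => (K i)ᴴ * K i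
  · exact (Equiv.sum_comp e fun i => K i * ρ * (K i)ᴴ).symm

theorem isQuantumOperation_discard {q : ℕ} [NeZero q] {Q E s : Type} [Fintype Q] [Fintype E]
    [DecidableEq Q] [DecidableEq E] [Fintype s] [DecidableEq s]
    (V : Matrix (Q ⊕ E → ZMod q) s ℂ) (hV : Vᴴ * V = 1) :
    IsQuantumOperation fun ρ : Matrix s s ℂ => _root_.discard (V * ρ * Vᴴ) := by
  have h := isQuantumOperation_of_kraus
    (fun e : E → ZMod q => Matrix.of fun (w : Q → ZMod q) i => V (Sum.elim w e) i) (by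
      rw [← hV]
      ext i j
      rw [Matrix.sum_apply]
      simp only [Matrix.mul_apply, Matrix.conjTranspose_apply, Matrix.of_apply]
      rw [← Fintype.sum_prod_type_right']
      exact (Fintype.sum_equiv (Equiv.sumArrowEquivProdArrow Q E (ZMod q)) _ _ fun w => by
        simp [Equiv.sumArrowEquivProdArrow]).symm)
  convert h using 2 with ρ
  ext a b
  rw [Matrix.sum_apply]
  simp only [_root_.discard, Matrix.of_apply]
  rfl

/-! ### Reduced states of superposed words -/

section Restriction

variable {q : ℕ} {Q E : Type}

/-- The restriction of a word to the qudits in `T`. -/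
def insideWord (E : Type) (T : Finset Q) : (Q ⊕ E → ZMod q) →ₗ[ZMod q] ({x // x ∈ T} → ZMod q) :=
  LinearMap.funLeft (ZMod q) (ZMod q) fun x => Sum.inl x.1

/-- The restriction of a word to the qudits that are not in `T`. -/
def outsideWord (E : Type) (T : Finset Q) :
    (Q ⊕ E → ZMod q) →ₗ[ZMod q] ({x // x ∉ T} ⊕ E → ZMod q) :=
  LinearMap.funLeft (ZMod q) (ZMod q) (Sum.map Subtype.val id)

theorem insideWord_eq_zero_iff {T : Finset Q} {w : Q ⊕ E → ZMod q} :
    insideWord E T w = 0 ↔ ∀ x ∈ T, w (Sum.inl x) = 0 := by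
  simp [insideWord, funext_iff]

theorem outsideWord_eq_zero_iff {T : Finset Q} {w : Q ⊕ E → ZMod q} :
    outsideWord E T w = 0 ↔ (∀ x ∉ T, w (Sum.inl x) = 0) ∧ ∀ e, w (Sum.inr e) = 0 := by
  simp [outsideWord, funext_iff]

theorem eq_glue_iff [DecidableEq Q] {T : Finset Q} {w : Q ⊕ E → ZMod q}
    {a : {x // x ∈ T} → ZMod q} {c : {x // x ∉ T} → ZMod q} {e : E → ZMod q} :
    w = Sum.elim (glue T a c) e ↔ insideWord E T w = a ∧ outsideWord E T w = Sum.elim c e := by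
  constructor
  · rintro rfl
    constructor
    · ext x
      simp [insideWord, glue]
    · ext (x | x)
      · simp [outsideWord, glue, x.2]
      · simp [outsideWord]
  · rintro ⟨rfl, h⟩
    ext (x | x)
    · by_cases hx : x ∈ T
      · simp [glue, hx, insideWord]
      · simpa [outsideWord, glue, hx] using congrFun h (Sum.inl ⟨x, hx⟩)
    · simpa [outsideWord] using congrFun h (Sum.inr x)

theorem reducedState_discard_superpose [NeZero q] [Fintype Q] [Fintype E] [DecidableEq Q]
    [DecidableEq E] {s R : Type} [Fintype s] [Fintype R] (f : s × R → (Q ⊕ E → ZMod q))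
    (T : Finset Q) (ρ : Matrix s s ℂ) :
    reducedState T (discard (superpose (fun i r => f (i, r)) * ρ *
      (superpose fun i r => f (i, r))ᴴ)) =
      superposedReduction (fun v => insideWord E T (f v)) (fun v => outsideWord E T (f v)) ρ := by
  ext a b
  simp only [reducedState, _root_.discard, superposedReduction, Matrix.of_apply,
    superpose_mul_mul_conjTranspose_apply, eq_glue_iff]
  refine (Fintype.sum_prod_type' _).symm.trans ?_
  rw [← Finset.mul_sum, Finset.sum_comm]
  congr 1
  refine Finset.sum_congr rfl fun i _ => ?_
  rw [Finset.sum_comm]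
  refine Finset.sum_congr rfl fun j _ => ?_
  rw [← Finset.mul_sum, Finset.sum_comm]
  congr 1
  refine Finset.sum_congr rfl fun r _ => ?_
  rw [Finset.sum_comm]
  refine Finset.sum_congr rfl fun t _ => ?_
  -- The two partial traces merge into one sum over labels outside `T`, which leaves the condition
  -- that the two outside words agree.
  rw [← Fintype.sum_equiv (Equiv.sumArrowEquivProdArrow {x // x ∉ T} E (ZMod q))
    (fun h => if (insideWord E T (f (i, r)) = a ∧ outsideWord E T (f (i, r)) = h) ∧
      (insideWord E T (f (j, t)) = b ∧ outsideWord E T (f (j, t)) = h) then (1 : ℂ) else 0)]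
  · rw [Fintype.sum_eq_single (outsideWord E T (f (i, r)))]
    · refine if_congr ?_ rfl rfl
      rw [eq_comm (a := outsideWord E T (f (i, r))) (b := outsideWord E T (f (j, t)))]
      tauto
    · intro h hh
      simp [hh.symm]
  · intro h
    simp [Equiv.sumArrowEquivProdArrow]

end Restriction

/-! ### Criteria for schemes that superpose linear words -/

namespace QSSScheme

variable {q m n : ℕ} [Fact q.Prime] {Q E R : Type} [Fintype Q] [Fintype E] [DecidableEq Q]
  [DecidableEq E] [Fintype R] [AddCommGroup R] [Module (ZMod q) R] {S : QSSScheme q m n Q}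
  {f : (Fin m → ZMod q) × R →ₗ[ZMod q] (Q ⊕ E → ZMod q)}

theorem isQuantumOperation_encode_of_superpose
    (hS : ∀ ρ, S.encode ρ = _root_.discard (superpose (fun i r => f (i, r)) * ρ *
      (superpose fun i r => f (i, r))ᴴ)) (hf : ∀ v, f v = 0 → v = 0) :
    IsQuantumOperation S.encode := by
  rw [funext hS]
  refine isQuantumOperation_discard (superpose fun i r => f (i, r))
    (isometry_superpose _ fun i j r t h => ?_)
  have := hf ((i, r) - (j, t)) (by rw [map_sub, h, sub_self])
  exact Prod.ext_iff.mp (sub_eq_zero.mp this)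

theorem noInformation_of_superpose
    (hS : ∀ ρ, S.encode ρ = _root_.discard (superpose (fun i r => f (i, r)) * ρ *
      (superpose fun i r => f (i, r))ᴴ)) (T : Finset Q)
    (hout : ∀ v, (∀ x ∉ T, f v (Sum.inl x) = 0) → (∀ e, f v (Sum.inr e) = 0) → v.1 = 0)
    (hin : ∀ i, ∃ r, ∀ x ∈ T, f (i, r) (Sum.inl x) = 0) : S.NoInformation T := by
  intro ρ σ hρ hσ
  ext a b
  rw [hS, hS, reducedState_discard_superpose, reducedState_discard_superpose]
  have h := superposedReduction_eq_trace_mul (insideWord E T ∘ₗ f) (outsideWord E T ∘ₗ f)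
    (fun v hv => (outsideWord_eq_zero_iff.mp hv).elim (hout v))
    (fun i => (hin i).imp fun _ hr => insideWord_eq_zero_iff.mpr hr)
  have h₁ := h ρ a b
  have h₂ := h σ a b
  rw [hρ.2] at h₁
  rw [hσ.2] at h₂
  exact h₁.trans h₂.symm

theorem recoverableFrom_of_superpose
    (hS : ∀ ρ, S.encode ρ = _root_.discard (superpose (fun i r => f (i, r)) * ρ *
      (superpose fun i r => f (i, r))ᴴ)) (hf : ∀ v, f v = 0 → v = 0) (T : Finset Q)
    (hin : ∀ v, (∀ x ∈ T, f v (Sum.inl x) = 0) → v.1 = 0)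
    (hout : ∀ i, ∃ r, (∀ x ∉ T, f (i, r) (Sum.inl x) = 0) ∧ ∀ e, f (i, r) (Sum.inr e) = 0) :
    S.RecoverableFrom T := by
  obtain ⟨Φ, hΦ, h⟩ := exists_recovery (insideWord E T ∘ₗ f) (outsideWord E T ∘ₗ f)
    (fun v h₁ h₂ => hf v (by
      have h₁ := insideWord_eq_zero_iff.mp h₁
      have h₂ := outsideWord_eq_zero_iff.mp h₂
      ext (x | x)
      · by_cases hx : x ∈ T
        exacts [h₁ x hx, h₂.1 x hx]
      · exact h₂.2 x))
    (fun v hv => hin v (insideWord_eq_zero_iff.mp hv))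
    (fun i => (hout i).imp fun _ hr => outsideWord_eq_zero_iff.mpr hr)
  refine ⟨Φ, hΦ, fun ρ _ => ?_⟩
  rw [hS, reducedState_discard_superpose]
  exact h ρ

end QSSScheme

/-! ### Zeros of the ramp and threshold codewords -/

section Words

variable {q : ℕ} [Fact q.Prime] {ι : Type}

theorem ogawaWord_eq_sum_append (m z : ℕ) (x : ι → ZMod q) (s : Fin m → ZMod q)
    (r : Fin z → ZMod q) (i : ι) :
    ogawaWord m z x s r i = ∑ a, Fin.append s r a * x i ^ (a : ℕ) := by
  simp [ogawaWord, Fin.sum_univ_add]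

theorem ogawaWord_eq_zero_of_card_le {m z : ℕ} {x : ι → ZMod q} (hx : Function.Injective x)
    {s : Fin m → ZMod q} {r : Fin z → ZMod q} (J : Finset ι) (hJ : m + z ≤ J.card)
    (h : ∀ i ∈ J, ogawaWord m z x s r i = 0) : s = 0 ∧ r = 0 := by
  have h0 := coeff_eq_zero_of_many_roots hx J hJ (Fin.append s r) fun i hi => by
    rw [← ogawaWord_eq_sum_append, h i hi]
  constructor
  · ext a
    simpa using congrFun h0 (Fin.castAdd z a)
  · ext a
    simpa using congrFun h0 (Fin.natAdd m a)

/-- The random part is `x ^ m` times a free polynomial of degree below `z`; nonzero nodes allow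
division by `x i ^ m` before interpolating. -/
theorem exists_ogawaWord_eq_zero {m z : ℕ} {x : ι → ZMod q} (hx : Function.Injective x)
    (hx0 : ∀ i, x i ≠ 0) (J : Finset ι) (hJ : J.card ≤ z) (s : Fin m → ZMod q) :
    ∃ r, ∀ i ∈ J, ogawaWord m z x s r i = 0 := by
  obtain ⟨r, hr⟩ := exists_coeff_interpolating hx J hJ
    fun i => -(∑ a, s a * x i ^ (a : ℕ)) / x i ^ m
  refine ⟨r, fun i hi => ?_⟩
  have h : ∑ b, r b * x i ^ (m + (b : ℕ)) = (∑ b, r b * x i ^ (b : ℕ)) * x i ^ m := by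
    rw [Finset.sum_mul]
    exact Finset.sum_congr rfl fun b _ => by ring
  rw [ogawaWord, h, hr i hi, div_mul_cancel₀ _ (pow_ne_zero _ (hx0 i)), add_neg_cancel]

theorem cleveWord_eq_zero_of_card_le {k : ℕ} (hk : 0 < k) {y : ι → ZMod q}
    (hy : Function.Injective y) {s : ZMod q} {r : Fin (k - 1) → ZMod q} (J : Finset ι)
    (hJ : k ≤ J.card) (h : ∀ i ∈ J, cleveWord k y s r i = 0) : s = 0 ∧ r = 0 := by
  have h0 := coeff_eq_zero_of_many_roots (N := k - 1 + 1) hy J (by omega)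
    (Fin.snoc (α := fun _ => ZMod q) r s) fun i hi => by
      rw [← h i hi]
      simp [cleveWord, Fin.sum_univ_castSucc]
  constructor
  · simpa using congrFun h0 (Fin.last _)
  · ext a
    simpa using congrFun h0 a.castSucc

/-- The secret is the top coefficient, so the random part is interpolated directly and a zero node
does no harm. -/
theorem exists_cleveWord_eq_zero {k : ℕ} {y : ι → ZMod q}
    (hy : Function.Injective y) (J : Finset ι) (hJ : J.card ≤ k - 1) (s : ZMod q) :
    ∃ r, ∀ i ∈ J, cleveWord k y s r i = 0 := by
  obtain ⟨r, hr⟩ := exists_coeff_interpolating hy J hJ fun i => -(s * y i ^ (k - 1))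
  exact ⟨r, fun i hi => by rw [cleveWord, hr i hi, neg_add_cancel]⟩

end Words

/-- The random symbols of the two layers. -/
abbrev ConcatRandomness (q k d : ℕ) : Type :=
  (Fin (k - 1) → ZMod q) × (Fin (d - k) → Fin (k - 1) → ZMod q)

/-! ### The concatenated encoding as one linear code -/

section Concatenation

variable {q : ℕ} [Fact q.Prime] (k n d : ℕ) (x : RampShare k n d → ZMod q)
  (y : ThresholdShare k n → ZMod q)

/-- The ramp codeword of a secret and the random symbols. -/
def rampWord (v : (Fin (d - k + 1) → ZMod q) × ConcatRandomness q k d) : RampShare k n d → ZMod q :=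
  ogawaWord (d - k + 1) (k - 1) x v.1 v.2.1

/-- The threshold codeword of the ramp share `A_{n+l}`. -/
def thresholdWord (v : (Fin (d - k + 1) → ZMod q) × ConcatRandomness q k d) (l : Fin (d - k)) :
    ThresholdShare k n → ZMod q :=
  cleveWord k y (rampWord k n d x v (Sum.inl (Sum.inr l))) (v.2.2 l)

/-- The words that the concatenated encoding superposes. -/
def concatWord : (Fin (d - k + 1) → ZMod q) × ConcatRandomness q k d →ₗ[ZMod q]
    (ShareQudit k n d ⊕ DiscardedQudit k n d → ZMod q) where
  toFun v := Sum.elim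
    (Sum.elim (fun j => rampWord k n d x v (Sum.inl (Sum.inl j)))
      fun p => thresholdWord k n d x y v p.1 (Sum.inl p.2))
    (Sum.elim (fun i => rampWord k n d x v (Sum.inr i))
      fun p => thresholdWord k n d x y v p.1 (Sum.inr p.2))
  map_add' v w := by
    ext ((j | p) | (i | p)) <;>
    simp only [rampWord, thresholdWord, ogawaWord, cleveWord, Sum.elim_inl, Sum.elim_inr,
      Prod.fst_add, Prod.snd_add, Pi.add_apply, add_mul, Finset.sum_add_distrib] <;> ring
  map_smul' c v := by
    ext ((j | p) | (i | p)) <;>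
    simp only [rampWord, thresholdWord, ogawaWord, cleveWord, Sum.elim_inl, Sum.elim_inr,
      Prod.smul_fst, Prod.smul_snd, Pi.smul_apply, smul_eq_mul, mul_assoc, ← Finset.mul_sum,
      RingHom.id_apply] <;> ring

theorem concatEncoding_eq_superpose :
    concatEncoding k n d x y = superpose fun s r => concatWord k n d x y (s, r) := by
  ext w s
  have hog : ∀ b, ogawaEncoding (d - k + 1) (k - 1) x b s =
      ((Real.sqrt (Fintype.card (Fin (k - 1) → ZMod q) : ℝ))⁻¹ : ℂ) *
        ∑ r, if ogawaWord (d - k + 1) (k - 1) x s r = b then 1 else 0 := fun b => rfl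
  rw [concatEncoding, Matrix.mul_apply]
  simp only [hog, Finset.mul_sum]
  rw [Finset.sum_comm]
  simp only [mul_ite, mul_one, mul_zero, Finset.sum_ite_eq, Finset.mem_univ, if_true]
  simp only [superpose, Matrix.of_apply, layerTwo, cleveEncoding]
  rw [Fintype.sum_prod_type, Finset.mul_sum]
  refine Finset.sum_congr rfl fun r _ => ?_
  -- The product of the `d - k` threshold sums expands into one sum over tuples `t` of random
  -- vectors.
  rw [Finset.prod_mul_distrib, Finset.prod_const, Finset.prod_univ_sum, Fintype.piFinset_univ]
  simp only [Finset.prod_ite_zero, Finset.prod_const_one]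
  rw [Finset.mul_sum, Finset.mul_sum, Finset.sum_mul, Finset.mul_sum]
  refine Finset.sum_congr rfl fun t _ => ?_
  have hiff : concatWord k n d x y (s, r, t) = w ↔
      ((∀ j, w (Sum.inl (Sum.inl j)) = ogawaWord (d - k + 1) (k - 1) x s r (Sum.inl (Sum.inl j))) ∧
        ∀ i, w (Sum.inr (Sum.inl i)) = ogawaWord (d - k + 1) (k - 1) x s r (Sum.inr i)) ∧
      ∀ l ∈ Finset.univ, cleveWord k y (ogawaWord (d - k + 1) (k - 1) x s r (Sum.inl (Sum.inr l)))
        (t l) = Sum.elim (fun j => w (Sum.inl (Sum.inr (l, j))))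
          (fun i => w (Sum.inr (Sum.inr (l, i)))) := by
    simp only [funext_iff, Sum.forall, concatWord, rampWord, thresholdWord, LinearMap.coe_mk,
      AddHom.coe_mk, Sum.elim_inl, Sum.elim_inr, Prod.forall, Finset.mem_univ, true_imp_iff,
      forall_and]
    constructor
    · rintro ⟨⟨h1, h2⟩, h3, h4⟩
      exact ⟨⟨fun j => (h1 j).symm, fun i => (h3 i).symm⟩, h2, h4⟩
    · rintro ⟨⟨h1, h3⟩, h2, h4⟩
      exact ⟨⟨fun j => (h1 j).symm, h2⟩, fun i => (h3 i).symm, h4⟩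
  have hcard : ((Real.sqrt (Fintype.card (ConcatRandomness q k d) : ℝ))⁻¹ : ℂ) =
      ((Real.sqrt (Fintype.card (Fin (k - 1) → ZMod q) : ℝ))⁻¹ : ℂ) ^ (d - k) *
        ((Real.sqrt (Fintype.card (Fin (k - 1) → ZMod q) : ℝ))⁻¹ : ℂ) := by
    have hpow : ∀ (a : ℝ) (e : ℕ), 0 ≤ a → Real.sqrt (a ^ e) = Real.sqrt a ^ e := by
      intro a e ha
      induction e with
      | zero => simp
      | succ e ih => rw [pow_succ, Real.sqrt_mul (pow_nonneg ha e), ih, pow_succ]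
    rw [Fintype.card_prod, Fintype.card_pi_const (Fin (k - 1) → ZMod q), Nat.cast_mul,
      Real.sqrt_mul (by positivity), Nat.cast_pow, hpow _ _ (by positivity)]
    push_cast
    rw [mul_inv, inv_pow, mul_comm]
  rw [hcard]
  simp only [hiff]
  by_cases h1 : (∀ j, w (Sum.inl (Sum.inl j)) =
      ogawaWord (d - k + 1) (k - 1) x s r (Sum.inl (Sum.inl j))) ∧
        ∀ i, w (Sum.inr (Sum.inl i)) = ogawaWord (d - k + 1) (k - 1) x s r (Sum.inr i)
  · simp [h1]
  · simp [h1]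


/-! ### Codewords vanishing on whole shares -/

variable {k n d x y}

/-- Layer one and layer two vanish on the shares of the parties and discarded indices in `J`. -/
def VanishesOn (x : RampShare k n d → ZMod q) (y : ThresholdShare k n → ZMod q)
    (v : (Fin (d - k + 1) → ZMod q) × ConcatRandomness q k d)
    (J : Finset (ThresholdShare k n)) : Prop :=
  ∀ i ∈ J, rampWord k n d x v (Sum.map Sum.inl id i) = 0 ∧
    ∀ l, thresholdWord k n d x y v l i = 0

theorem rampShare_injective : Function.Injective
    (Sum.map Sum.inl id : ThresholdShare k n → RampShare k n d) :=
  Function.Injective.sumMap Sum.inl_injective Function.injective_id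

/-- The ramp shares at positions in `J`, and those that are encoded again. -/
def rampPositions (d : ℕ) (J : Finset (ThresholdShare k n)) : Finset (RampShare k n d) :=
  J.map ⟨_, rampShare_injective⟩ ∪
    (Finset.univ : Finset (Fin (d - k))).map
      (Function.Embedding.inr.trans Function.Embedding.inl)

theorem card_rampPositions (J : Finset (ThresholdShare k n)) :
    (rampPositions d J).card = J.card + (d - k) := by
  rw [rampPositions, Finset.card_union_of_disjoint, Finset.card_map, Finset.card_map,
    Finset.card_univ, Fintype.card_fin]
  rw [Finset.disjoint_left]
  rintro a ha hb
  simp only [Finset.mem_map, Function.Embedding.coeFn_mk] at ha hb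
  obtain ⟨(i | i), -, rfl⟩ := ha <;> obtain ⟨l, -, hl⟩ := hb <;>
    simp at hl

theorem forall_mem_rampPositions {J : Finset (ThresholdShare k n)} {p : RampShare k n d → Prop} :
    (∀ i ∈ rampPositions d J, p i) ↔
      (∀ i ∈ J, p (Sum.map Sum.inl id i)) ∧ ∀ l, p (Sum.inl (Sum.inr l)) := by
  simp only [rampPositions, Finset.mem_union, Finset.mem_map, Finset.mem_univ, true_and,
    Function.Embedding.coeFn_mk, Function.Embedding.trans_apply, Function.Embedding.inl_apply,
    Function.Embedding.inr_apply]
  constructor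
  · exact fun h => ⟨fun i hi => h _ (Or.inl ⟨i, hi, rfl⟩), fun l => h _ (Or.inr ⟨l, rfl⟩)⟩
  · rintro ⟨h1, h2⟩ _ (⟨i, hi, rfl⟩ | ⟨l, rfl⟩)
    exacts [h1 i hi, h2 l]

/-- `k` zeros annihilate each threshold word, hence the `d - k` re-encoded ramp shares. With the `k`
first layers, the ramp polynomial has `d` zeros and only `d` coefficients. -/
theorem eq_zero_of_vanishesOn (hk : 1 < k) (hx : Function.Injective x)
    (hy : Function.Injective y) {v : (Fin (d - k + 1) → ZMod q) × ConcatRandomness q k d}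
    {J : Finset (ThresholdShare k n)} (hJ : k ≤ J.card) (hv : VanishesOn x y v J) : v = 0 := by
  have h1 : ∀ l, rampWord k n d x v (Sum.inl (Sum.inr l)) = 0 ∧ v.2.2 l = 0 := fun l =>
    cleveWord_eq_zero_of_card_le (by omega) hy J hJ fun i hi => (hv i hi).2 l
  have h2 : v.1 = 0 ∧ v.2.1 = 0 :=
    ogawaWord_eq_zero_of_card_le hx (rampPositions d J) (by rw [card_rampPositions]; omega)
      (forall_mem_rampPositions.mpr ⟨fun i hi => (hv i hi).1, fun l => (h1 l).1⟩)
  exact Prod.ext h2.1 (Prod.ext h2.2 (funext fun l => (h1 l).2))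

theorem exists_vanishesOn (hx : Function.Injective x) (hx0 : ∀ i, x i ≠ 0)
    (hy : Function.Injective y) {J : Finset (ThresholdShare k n)} (hJ : J.card ≤ k - 1)
    (s : Fin (d - k + 1) → ZMod q) :
    ∃ r : ConcatRandomness q k d, VanishesOn x y (s, r) J := by
  obtain ⟨r, hr⟩ := exists_ogawaWord_eq_zero (z := k - 1) hx hx0
    (J.map ⟨_, rampShare_injective⟩) (by rwa [Finset.card_map]) s
  choose t ht using fun l => exists_cleveWord_eq_zero hy J hJ
    (ogawaWord (d - k + 1) (k - 1) x s r (Sum.inl (Sum.inr l)))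
  exact ⟨(r, t), fun i hi => ⟨hr _ (Finset.mem_map_of_mem _ hi), fun l => ht l i hi⟩⟩

theorem fst_eq_zero_of_rampWord_eq_zero (hk : 1 < k) (hkd : k < d) (hx : Function.Injective x)
    {v : (Fin (d - k + 1) → ZMod q) × ConcatRandomness q k d} (D : Finset (Fin n))
    (hD : d ≤ D.card) (h : ∀ j ∈ D, rampWord k n d x v (Sum.inl (Sum.inl j)) = 0) : v.1 = 0 :=
  (ogawaWord_eq_zero_of_card_le (z := k - 1) (r := v.2.1) hx
    (D.map (Function.Embedding.inl.trans Function.Embedding.inl))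
    (by rw [Finset.card_map]; omega) fun i hi => by
      obtain ⟨j, hj, rfl⟩ := Finset.mem_map.mp hi
      exact h j hj).1

/-- The ramp randomness also cancels the re-encoded shares; zero threshold randomness then makes the
entire second layer vanish. -/
theorem exists_rampWord_eq_zero (hx : Function.Injective x) (hx0 : ∀ i, x i ≠ 0)
    {J : Finset (ThresholdShare k n)} (hJ : J.card + (d - k) ≤ k - 1)
    (s : Fin (d - k + 1) → ZMod q) : ∃ r : ConcatRandomness q k d,
      (∀ i ∈ J, rampWord k n d x (s, r) (Sum.map Sum.inl id i) = 0) ∧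
        ∀ l i, thresholdWord k n d x y (s, r) l i = 0 := by
  obtain ⟨r, hr⟩ := exists_ogawaWord_eq_zero (z := k - 1) hx hx0 (rampPositions d J)
    (by rwa [card_rampPositions]) s
  have hr := forall_mem_rampPositions.mp hr
  refine ⟨(r, 0), hr.1, fun l i => ?_⟩
  simp [thresholdWord, cleveWord, rampWord, hr.2 l]

theorem vanishesOn_disjSum_iff {v : (Fin (d - k + 1) → ZMod q) × ConcatRandomness q k d}
    {D : Finset (Fin n)} {G : Finset (Fin (2 * k - 1 - n))} :
    VanishesOn x y v (D.disjSum G) ↔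
      (∀ p : ShareQudit k n d, Sum.elim id Prod.snd p ∈ D →
        concatWord k n d x y v (Sum.inl p) = 0) ∧
      ∀ e : DiscardedQudit k n d, Sum.elim id Prod.snd e ∈ G →
        concatWord k n d x y v (Sum.inr e) = 0 := by
  simp only [VanishesOn, Sum.forall, Finset.inl_mem_disjSum, Finset.inr_mem_disjSum, concatWord,
    LinearMap.coe_mk, AddHom.coe_mk, Sum.elim_inl, Sum.elim_inr, Sum.map_inl, Sum.map_inr, id,
    Prod.forall]
  constructor
  · rintro ⟨h1, h2⟩
    exact ⟨⟨fun j hj => (h1 j hj).1, fun l j hj => (h1 j hj).2 l⟩,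
      fun j hj => (h2 j hj).1, fun l j hj => (h2 j hj).2 l⟩
  · rintro ⟨⟨h1, h2⟩, h3, h4⟩
    exact ⟨fun j hj => ⟨h1 j hj, fun l => h2 l j hj⟩, fun j hj => ⟨h3 j hj, fun l => h4 l j hj⟩⟩

theorem card_compl_disjSum_univ (hn : n ≤ 2 * k - 1) (D : Finset (Fin n)) :
    (Dᶜ.disjSum (Finset.univ : Finset (Fin (2 * k - 1 - n)))).card = 2 * k - 1 - D.card := by
  have := card_finset_fin_le D
  rw [Finset.card_disjSum, Finset.card_compl, Finset.card_univ, Fintype.card_fin, Fintype.card_fin]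
  omega

theorem concatWord_injective (hk : 1 < k) (hn : n ≤ 2 * k - 1)
    (hx : Function.Injective x) (hy : Function.Injective y)
    (v : (Fin (d - k + 1) → ZMod q) × ConcatRandomness q k d)
    (hv : concatWord k n d x y v = 0) : v = 0 := by
  refine eq_zero_of_vanishesOn hk hx hy (J := (∅ : Finset (Fin n))ᶜ.disjSum Finset.univ)
    ?_ (vanishesOn_disjSum_iff.mpr ⟨fun p _ => by rw [hv]; rfl, fun e _ => by rw [hv]; rfl⟩)
  rw [card_compl_disjSum_univ hn, Finset.card_empty]
  omega

/-! ### Recovery, secrecy and costs of the scheme -/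

theorem concatScheme_encode (ρ : QOp q (Fin (d - k + 1))) :
    (concatScheme k n d x y).encode ρ =
      _root_.discard (superpose (fun s r => concatWord k n d x y (s, r)) * ρ *
        (superpose fun s r => concatWord k n d x y (s, r))ᴴ) := by
  rw [← concatEncoding_eq_superpose]
  rfl

theorem mem_shares_concatScheme {D : Finset (Fin n)} {p : ShareQudit k n d} :
    p ∈ (concatScheme k n d x y).shares D ↔ Sum.elim id Prod.snd p ∈ D := by
  rw [QSSScheme.shares, Finset.mem_filter]
  exact and_iff_right (Finset.mem_univ p)

theorem recoverableFrom_shares (hk : 1 < k) (hn : n ≤ 2 * k - 1)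
    (hx : Function.Injective x) (hx0 : ∀ i, x i ≠ 0) (hy : Function.Injective y)
    (D : Finset (Fin n)) (hD : k ≤ D.card) :
    (concatScheme k n d x y).RecoverableFrom ((concatScheme k n d x y).shares D) := by
  refine QSSScheme.recoverableFrom_of_superpose
    (f := concatWord k n d x y) concatScheme_encode
    (concatWord_injective hk hn hx hy) _ (fun v hv => ?_) fun s => ?_
  · have h : VanishesOn x y v (D.disjSum ∅) :=
      vanishesOn_disjSum_iff.mpr ⟨fun p hp => hv p (mem_shares_concatScheme.mpr hp), by simp⟩
    rw [eq_zero_of_vanishesOn hk hx hy (by simpa using hD) h]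
    rfl
  · obtain ⟨r, hr⟩ := exists_vanishesOn (d := d) hx hx0 hy
      (J := Dᶜ.disjSum Finset.univ) (by rw [card_compl_disjSum_univ hn]; omega) s
    have hr := vanishesOn_disjSum_iff.mp hr
    refine ⟨r, fun p hp => hr.1 p ?_, fun e => hr.2 e (Finset.mem_univ _)⟩
    rwa [Finset.mem_compl, ← mem_shares_concatScheme (x := x) (y := y)]

theorem noInformation_shares (hk : 1 < k) (hn : n ≤ 2 * k - 1)
    (hx : Function.Injective x) (hx0 : ∀ i, x i ≠ 0) (hy : Function.Injective y)
    (D : Finset (Fin n)) (hD : D.card < k) :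
    (concatScheme k n d x y).NoInformation ((concatScheme k n d x y).shares D) := by
  refine QSSScheme.noInformation_of_superpose
    (f := concatWord k n d x y) concatScheme_encode _ (fun v hv he => ?_) fun s => ?_
  · have h : VanishesOn x y v (Dᶜ.disjSum Finset.univ) :=
      vanishesOn_disjSum_iff.mpr ⟨fun p hp => hv p (by
        rwa [mem_shares_concatScheme, ← Finset.mem_compl]), fun e _ => he e⟩
    rw [eq_zero_of_vanishesOn hk hx hy (by rw [card_compl_disjSum_univ hn]; omega) h]
    rfl
  · obtain ⟨r, hr⟩ := exists_vanishesOn (d := d) hx hx0 hy (J := D.disjSum ∅)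
      (by rw [Finset.card_disjSum, Finset.card_empty]; omega) s
    exact ⟨r, fun p hp => (vanishesOn_disjSum_iff.mp hr).1 p (mem_shares_concatScheme.mp hp)⟩

theorem recoverableFrom_first_layer (hk : 1 < k) (hkd : k < d) (hn : n ≤ 2 * k - 1)
    (hx : Function.Injective x) (hx0 : ∀ i, x i ≠ 0) (hy : Function.Injective y)
    (D : Finset (Fin n)) (hD : D.card = d) (hdn : d ≤ n) :
    (concatScheme k n d x y).RecoverableFrom (D.map Function.Embedding.inl) := by
  refine QSSScheme.recoverableFrom_of_superpose
    (f := concatWord k n d x y) concatScheme_encode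
    (concatWord_injective hk hn hx hy) _ (fun v hv => ?_) fun s => ?_
  · exact fst_eq_zero_of_rampWord_eq_zero hk hkd hx D hD.ge fun j hj =>
      hv (Sum.inl j) (Finset.mem_map_of_mem _ hj)
  -- The outside consists of `2k - 1 - d` first-layer positions and the second layer of everyone;
  -- adding the `d - k` re-encoded shares gives exactly `k - 1` zeros to impose.
  · obtain ⟨r, hr, hr'⟩ := exists_rampWord_eq_zero (d := d) (y := y) hx hx0
      (J := Dᶜ.disjSum Finset.univ) (by rw [card_compl_disjSum_univ hn]; omega) s
    refine ⟨r, ?_, ?_⟩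
    · rintro (j | p) hp
      · exact hr (Sum.inl j) (by simpa using hp)
      · exact hr' p.1 (Sum.inl p.2)
    · rintro (i | p)
      · exact hr (Sum.inr i) (by simp)
      · exact hr' p.1 (Sum.inr p.2)

theorem card_shares_concatScheme (D : Finset (Fin n)) :
    ((concatScheme k n d x y).shares D).card = D.card * (d - k + 1) := by
  have h : (concatScheme k n d x y).shares D =
      D.disjSum ((Finset.univ : Finset (Fin (d - k))) ×ˢ D) := by
    ext (p | p) <;> simp [mem_shares_concatScheme]
  rw [h, Finset.card_disjSum, Finset.card_product, Finset.card_univ, Fintype.card_fin]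
  ring

theorem sent_concatScheme (D : Finset (Fin n)) : (concatScheme k n d x y).sent D =
    if D.card = d then D.map Function.Embedding.inl else (concatScheme k n d x y).shares D := by
  rfl

omit [Fact q.Prime] in
theorem commCost_eq_of_card_sent {m : ℕ} {Q : Type} (S : QSSScheme q m n Q) {c e : ℕ} (hc : c ≤ n)
    (h : ∀ D : Finset (Fin n), D.card = c → (S.sent D).card = e) : S.commCost c = e := by
  -- Some set of size `c` must exist, since an empty supremum would be `0`.
  obtain ⟨D, hD⟩ := Finset.powersetCard_nonempty (n := c) (s := (Finset.univ : Finset (Fin n))).mpr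
    (by simpa using hc)
  refine le_antisymm (Finset.sup_le fun D hD => (h D (Finset.mem_powersetCard.mp hD).2).le) ?_
  rw [← h D (Finset.mem_powersetCard.mp hD).2]
  exact Finset.le_sup (f := fun D => (S.sent D).card) hD

end Concatenation

theorem mainTheorem7 (q k n d : ℕ) [Fact q.Prime] (hk : 1 < k) (hn : n ≤ 2 * k - 1)
    (hkd : k < d) (hdn : d ≤ n) (hq : d + k - 1 < q) :
    (∃ (x : RampShare k n d → ZMod q) (y : ThresholdShare k n → ZMod q),
      Function.Injective x ∧ (∀ i, x i ≠ 0) ∧ Function.Injective y) ∧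
    ∀ (x : RampShare k n d → ZMod q) (y : ThresholdShare k n → ZMod q),
      Function.Injective x → (∀ i, x i ≠ 0) → Function.Injective y →
      (concatScheme k n d x y).IsCEQTS k d ∧
        (∀ j, (concatScheme k n d x y).shareSize j = d - k + 1) ∧
        (concatScheme k n d x y).commCost k = k * (d - k + 1) ∧
        (concatScheme k n d x y).commCost d = d := by
  constructor
  -- There are `d + k - 1` ramp nodes, at most the `q - 1` units.
  · obtain ⟨x⟩ := Function.Embedding.nonempty_of_card_le (α := RampShare k n d)
      (β := (ZMod q)ˣ) (by
        rw [ZMod.card_units]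
        simp only [RampShare, Fintype.card_sum, Fintype.card_fin]
        omega)
    obtain ⟨y⟩ := Function.Embedding.nonempty_of_card_le (α := ThresholdShare k n)
      (β := ZMod q) (by
        rw [ZMod.card]
        simp only [ThresholdShare, Fintype.card_sum, Fintype.card_fin]
        omega)
    exact ⟨fun i => x i, y, fun i j h => x.injective (Units.ext h), fun i => (x i).ne_zero,
      y.injective⟩
  intro x y hx hx0 hy
  have hck : (concatScheme k n d x y).commCost k = k * (d - k + 1) :=
    commCost_eq_of_card_sent _ (by omega) fun D hD => by
      rw [sent_concatScheme, if_neg (by omega), card_shares_concatScheme, hD]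
  have hcd : (concatScheme k n d x y).commCost d = d :=
    commCost_eq_of_card_sent _ hdn fun D hD => by
      rw [sent_concatScheme, if_pos hD, Finset.card_map, hD]
  refine ⟨⟨⟨hk, by omega, hn, ⟨?_, ?_, ?_⟩⟩, hkd, hdn, ?_, ?_⟩, ?_, hck, hcd⟩
  · exact QSSScheme.isQuantumOperation_encode_of_superpose
      (f := concatWord k n d x y) concatScheme_encode
      (concatWord_injective hk hn hx hy)
  · exact fun D hD => recoverableFrom_shares hk hn hx hx0 hy D hD
  · exact fun D hD => noInformation_shares hk hn hx hx0 hy D (not_le.mp hD)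
  · intro D hD
    rw [sent_concatScheme]
    split_ifs with h
    · refine ⟨fun p hp => ?_, recoverableFrom_first_layer hk hkd hn hx hx0 hy D h hdn⟩
      obtain ⟨j, hj, rfl⟩ := Finset.mem_map.mp hp
      exact mem_shares_concatScheme.mpr hj
    · exact ⟨subset_rfl, recoverableFrom_shares hk hn hx hx0 hy D hD⟩
  · rw [hck, hcd]
    -- The gap `k * (d - k + 1) - d` equals `(k - 1) * (d - k)`, positive as `1 < k < d`; the
    -- substitution removes truncated subtraction.
    obtain ⟨t, rfl⟩ : ∃ t, d = k + 1 + t := ⟨d - (k + 1), by omega⟩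
    rw [show k + 1 + t - k = 1 + t by omega]
    nlinarith [Nat.zero_le (k * t), Nat.mul_le_mul_right t hk.le]
  · intro j
    rw [QSSScheme.shareSize, card_shares_concatScheme, Finset.card_singleton, one_mul]
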